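/- **Theorem.** For integers $m,n$ put $$J(m,n)=\int_0^\infty \frac{\tanh^m(z)}{z^n}\,dz .$$ Let $m\ge n\ge 2$ be integers of the same parity. Then the integral $J(m,n)$ converges absolutely, and $$J(m,n)=\binom{m+\lfloor m/2\rfloor}{m}\sum_{\substack{1\le j\le m\\ j\equiv m\ (\mathrm{mod}\ 2)}}\binom{-n}{j-1}\,\frac{2^{n+j-1}-1}{(\pi i)^{n+j-2}}\,\zeta(n+j-1)\,\sum_{\lambda=0}^{m}\sum_{\mu=0}^{\lfloor m/2\rfloor}\sum_{\nu=0}^{\mu}(-1)^{\mu+\nu}\frac{m}{m+\mu}\binom{m}{\lambda}\binom{\lfloor m/2\rfloor}{\mu}\binom{\mu}{\nu}\frac{(m-2\lambda+\mu-2\nu)^{m+\mu-j}}{2^{m+\mu}\,(m+\mu-j)!},$$ where $\zeta$ is the Riemann zeta function, $\binom{-n}{r}=\frac{(-n)(-n-1)\cdots(-n-r+1)}{r!}$, and $0^0=1$. Hence there are rational numbers $c_k$ (depending on $m$ and $n$) such that $$J(m,n)=\sum_{k=1}^{\lceil m/2\rceil} c_k\,\frac{\zeta(m+n-2k+1)}{\pi^{m+n-2k}}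 .$$ For example, $J(2,2)=\dfrac{14\,\zeta(3)}{\pi^2}$. -/

import Mathlib

/-- The integrand `tanh(z)^m / z^n`. -/
noncomputable def tanhIntegrand (m n : ℕ) (z : ℝ) : ℝ :=
  Real.tanh z ^ m / z ^ n

/-- The integral `J(m, n) = ∫_0^∞ tanh(z)^m / z^n dz`. -/
noncomputable def tanhIntegral (m n : ℕ) : ℝ :=
  ∫ z in Set.Ioi (0 : ℝ), tanhIntegrand m n z

/-- The power series of `cosh`. -/
noncomputable def coshSeries : PowerSeries ℚ :=
  PowerSeries.mk fun n => if Even n then 1 / (n.factorial : ℚ) else 0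

/-- The power series of `sinh X / X`. -/
noncomputable def sinhDivSeries : PowerSeries ℚ :=
  PowerSeries.mk fun n => if Even n then 1 / ((n + 1).factorial : ℚ) else 0

/-- The power series of `X * coth X`. -/
noncomputable def mulCothSeries : PowerSeries ℚ := coshSeries * sinhDivSeries⁻¹

theorem constantCoeff_sinhDivSeries : PowerSeries.constantCoeff sinhDivSeries = 1 := by
  rw [← PowerSeries.coeff_zero_eq_constantCoeff_apply]
  simp [sinhDivSeries]

theorem sinhDivSeries_mul_inv : sinhDivSeries * sinhDivSeries⁻¹ = 1 :=
  PowerSeries.mul_inv_cancel _ (by rw [constantCoeff_sinhDivSeries]; exact one_ne_zero)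

theorem mulCothSeries_mul_sinhDivSeries : mulCothSeries * sinhDivSeries = coshSeries := by
  rw [mulCothSeries, mul_assoc, mul_comm sinhDivSeries⁻¹, sinhDivSeries_mul_inv, mul_one]

theorem derivative_coshSeries :
    PowerSeries.derivative ℚ coshSeries = PowerSeries.X * sinhDivSeries := by
  ext n
  rw [PowerSeries.coeff_derivative]
  cases n with
  | zero => simp [coshSeries]
  | succ n =>
    rw [PowerSeries.coeff_succ_X_mul]
    simp only [coshSeries, sinhDivSeries, PowerSeries.coeff_mk, Nat.even_add_one, not_not]
    split_ifs
    · rw [Nat.factorial_succ (n + 1)]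
      have := Nat.factorial_ne_zero (n + 1)
      push_cast
      field_simp
    · simp

theorem X_mul_derivative_sinhDivSeries :
    PowerSeries.X * PowerSeries.derivative ℚ sinhDivSeries = coshSeries - sinhDivSeries := by
  ext n
  cases n with
  | zero => simp [coshSeries, sinhDivSeries]
  | succ n =>
    rw [PowerSeries.coeff_succ_X_mul, PowerSeries.coeff_derivative]
    simp only [coshSeries, sinhDivSeries, PowerSeries.coeff_mk, map_sub]
    split_ifs
    · rw [Nat.factorial_succ (n + 1)]
      have := Nat.factorial_ne_zero (n + 1)
      push_cast
      field_simp
      ring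
    · simp

theorem X_mul_derivative_mulCothSeries :
    PowerSeries.X * PowerSeries.derivative ℚ mulCothSeries =
      mulCothSeries + PowerSeries.X ^ 2 - mulCothSeries ^ 2 := by
  have h1 := congrArg (PowerSeries.derivative ℚ) mulCothSeries_mul_sinhDivSeries
  rw [Derivation.leibniz, derivative_coshSeries, smul_eq_mul, smul_eq_mul] at h1
  have h2 := X_mul_derivative_sinhDivSeries
  have h3 := mulCothSeries_mul_sinhDivSeries
  have h4 := sinhDivSeries_mul_inv
  generalize sinhDivSeries⁻¹ = r at *
  generalize PowerSeries.derivative ℚ mulCothSeries = B' at *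
  generalize PowerSeries.derivative ℚ sinhDivSeries = s' at *
  generalize mulCothSeries = B at *
  generalize coshSeries = c at *
  generalize sinhDivSeries = s at *
  subst h3
  have h5 : s * (PowerSeries.X * B' - (B + PowerSeries.X ^ 2 - B ^ 2)) = 0 := by
    linear_combination PowerSeries.X * h1 - B * h2
  have h6 := congrArg (r * ·) h5
  simp only [← mul_assoc, mul_comm r s, h4, one_mul, mul_zero] at h6
  exact sub_eq_zero.mp h6

theorem mulCothSeries_pow_succ (m : ℕ) :
    ((m + 1 : ℕ) : PowerSeries ℚ) * mulCothSeries ^ (m + 2) =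
      ((m + 1 : ℕ) : PowerSeries ℚ) * mulCothSeries ^ (m + 1) +
        ((m + 1 : ℕ) : PowerSeries ℚ) * (PowerSeries.X ^ 2 * mulCothSeries ^ m) -
        PowerSeries.X * PowerSeries.derivative ℚ (mulCothSeries ^ (m + 1)) := by
  rw [PowerSeries.derivative_pow, Nat.add_sub_cancel]
  linear_combination (((m + 1 : ℕ) : PowerSeries ℚ) * mulCothSeries ^ m) *
    X_mul_derivative_mulCothSeries

/-- The coefficient of `z⁻ʲ` in the Laurent expansion of `coth(z)^m` at `0`. -/
noncomputable def cothCoeff (m j : ℕ) : ℚ :=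
  if j ≤ m then PowerSeries.coeff (m - j) (mulCothSeries ^ m) else 0

theorem cothCoeff_recurrence (m j : ℕ) :
    cothCoeff (m + 2) (j + 1) =
      cothCoeff m (j + 1) + (j : ℚ) / (m + 1) * cothCoeff (m + 1) j := by
  have hm : ((m : ℚ) + 1) ≠ 0 := by positivity
  have key : ∀ d, ((m : ℚ) + 1) * PowerSeries.coeff d (mulCothSeries ^ (m + 2)) =
      ((m : ℚ) + 1 - d) * PowerSeries.coeff d (mulCothSeries ^ (m + 1)) +
        ((m : ℚ) + 1) * (if 2 ≤ d then PowerSeries.coeff (d - 2) (mulCothSeries ^ m) else 0) := by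
    intro d
    have h := congrArg (PowerSeries.coeff d) (mulCothSeries_pow_succ m)
    have hC : ((m + 1 : ℕ) : PowerSeries ℚ) = PowerSeries.C ((m : ℚ) + 1) := by simp
    rw [hC, map_sub, LinearMap.map_add, PowerSeries.coeff_C_mul, PowerSeries.coeff_C_mul,
      PowerSeries.coeff_C_mul, PowerSeries.coeff_X_pow_mul'] at h
    have hX : PowerSeries.coeff d (PowerSeries.X *
        PowerSeries.derivative ℚ (mulCothSeries ^ (m + 1))) =
        d * PowerSeries.coeff d (mulCothSeries ^ (m + 1)) := by
      cases d with
      | zero => simp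
      | succ d => rw [PowerSeries.coeff_succ_X_mul, PowerSeries.coeff_derivative]; push_cast; ring
    rw [hX] at h
    rw [h]
    ring
  rcases lt_or_ge (m + 1) j with hj | hj
  · rw [cothCoeff, cothCoeff, cothCoeff, if_neg (by omega), if_neg (by omega), if_neg (by omega)]
    simp
  · have h := key (m + 1 - j)
    have e1 : cothCoeff (m + 2) (j + 1) =
        PowerSeries.coeff (m + 1 - j) (mulCothSeries ^ (m + 2)) := by
      rw [cothCoeff, if_pos (by omega)]; congr 2; omega
    have e2 : cothCoeff m (j + 1) = if 2 ≤ m + 1 - j then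
        PowerSeries.coeff (m + 1 - j - 2) (mulCothSeries ^ m) else 0 := by
      rw [cothCoeff]
      by_cases h' : j + 1 ≤ m
      · rw [if_pos h', if_pos (by omega)]; congr 2; omega
      · rw [if_neg h', if_neg (by omega)]
    have e3 : cothCoeff (m + 1) j = PowerSeries.coeff (m + 1 - j) (mulCothSeries ^ (m + 1)) := by
      rw [cothCoeff, if_pos hj]
    rw [← e1, ← e2, ← e3, Nat.cast_sub hj] at h
    push_cast at h
    field_simp
    linear_combination h

theorem cothCoeff_one_one : cothCoeff 1 1 = 1 := by
  have h : PowerSeries.constantCoeff mulCothSeries = 1 := by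
    have := congrArg PowerSeries.constantCoeff mulCothSeries_mul_sinhDivSeries
    rw [map_mul, constantCoeff_sinhDivSeries, mul_one] at this
    rw [this, ← PowerSeries.coeff_zero_eq_constantCoeff_apply]
    simp [coshSeries]
  simp [cothCoeff, h]

theorem coshSeries_eq : coshSeries = PowerSeries.C (1 / 2) *
    (PowerSeries.exp ℚ + PowerSeries.rescale (-1) (PowerSeries.exp ℚ)) := by
  ext n
  rw [PowerSeries.coeff_C_mul, map_add, PowerSeries.coeff_rescale, PowerSeries.coeff_exp]
  simp only [coshSeries, PowerSeries.coeff_mk, eq_ratCast, Rat.cast_id]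
  split_ifs with h
  · rw [h.neg_one_pow]; ring
  · rw [(Nat.not_even_iff_odd.mp h).neg_one_pow]; ring

theorem X_mul_sinhDivSeries_eq : PowerSeries.X * sinhDivSeries = PowerSeries.C (1 / 2) *
    (PowerSeries.exp ℚ + PowerSeries.C (-1) * PowerSeries.rescale (-1) (PowerSeries.exp ℚ)) := by
  ext n
  rw [PowerSeries.coeff_C_mul, map_add, PowerSeries.coeff_C_mul, PowerSeries.coeff_rescale,
    PowerSeries.coeff_exp]
  cases n with
  | zero => simp
  | succ n =>
    rw [PowerSeries.coeff_succ_X_mul]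
    simp only [sinhDivSeries, PowerSeries.coeff_mk, eq_ratCast, Rat.cast_id]
    split_ifs with h
    · rw [h.add_one.neg_one_pow]; ring
    · rw [(Nat.not_even_iff_odd.mp h).add_one.neg_one_pow]; ring

theorem coeff_exp_pow_mul (a b d : ℕ) :
    PowerSeries.coeff d (PowerSeries.exp ℚ ^ a *
      PowerSeries.rescale (-1) (PowerSeries.exp ℚ) ^ b) =
      ((a : ℚ) - b) ^ d / d.factorial := by
  rw [← map_pow, PowerSeries.exp_pow_eq_rescale_exp, PowerSeries.exp_pow_eq_rescale_exp,
    PowerSeries.rescale_rescale, PowerSeries.exp_mul_exp_eq_exp_add, PowerSeries.coeff_rescale,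
    PowerSeries.coeff_exp]
  simp only [eq_ratCast, Rat.cast_id]
  ring

theorem coeff_cosh_pow_mul_sinh_pow (m k d : ℕ) :
    PowerSeries.coeff d (coshSeries ^ m * (PowerSeries.X * sinhDivSeries) ^ k) =
      ∑ i ∈ Finset.range (m + 1), ∑ l ∈ Finset.range (k + 1),
        (-1) ^ l * (m.choose i : ℚ) * (k.choose l : ℚ) *
          (((m : ℚ) - 2 * i + k - 2 * l) ^ d / (2 ^ (m + k) * d.factorial)) := by
  rw [coshSeries_eq, X_mul_sinhDivSeries_eq, mul_pow, mul_pow,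
    add_comm (PowerSeries.exp ℚ), add_comm (PowerSeries.exp ℚ), add_pow, add_pow,
    ← map_pow, ← map_pow, mul_mul_mul_comm, ← map_mul, PowerSeries.coeff_C_mul,
    Finset.sum_mul_sum, map_sum, Finset.mul_sum]
  refine Finset.sum_congr rfl fun i hi => ?_
  rw [map_sum, Finset.mul_sum]
  refine Finset.sum_congr rfl fun l hl => ?_
  have hi' : i ≤ m := by simpa [Nat.lt_succ_iff] using hi
  have hl' : l ≤ k := by simpa [Nat.lt_succ_iff] using hl
  have e : ∀ E F : PowerSeries ℚ, F ^ i * E ^ (m - i) * (m.choose i : PowerSeries ℚ) *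
      ((PowerSeries.C (-1) * F) ^ l * E ^ (k - l) * (k.choose l : PowerSeries ℚ)) =
      PowerSeries.C ((-1) ^ l * (m.choose i : ℚ) * (k.choose l : ℚ)) *
        (E ^ (m - i + (k - l)) * F ^ (i + l)) := by
    intro E F
    simp only [map_mul, map_pow, map_natCast, mul_pow, pow_add]
    ring
  rw [e, PowerSeries.coeff_C_mul, coeff_exp_pow_mul]
  push_cast [Nat.cast_sub hi', Nat.cast_sub hl']
  rw [show (m : ℚ) - i + (k - l) - (i + l) = m - 2 * i + k - 2 * l by ring]
  rw [pow_add, one_div_pow, one_div_pow]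
  field_simp

open Polynomial in
/-- A multiple of the incomplete beta function, divided by `X ^ m`. -/
noncomputable def betaPoly (M m : ℕ) : ℚ[X] :=
  ∑ i ∈ Finset.range (M + 1), C ((-1) ^ i * ((m : ℚ) / (m + i)) * (M.choose i : ℚ)) * X ^ i

open Polynomial in
theorem sum_choose_mul_derivative (M m : ℕ) :
    (M + 1 : ℚ[X]) * ∑ i ∈ Finset.range (m + 1), C ((M + i).choose i : ℚ) * X ^ i -
      (1 - X) * derivative (∑ i ∈ Finset.range (m + 1), C ((M + i).choose i : ℚ) * X ^ i) =
      C (((M + m + 1) * (M + m).choose m : ℕ) : ℚ) * X ^ m := by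
  induction m with
  | zero => simp
  | succ m ih =>
    rw [Finset.sum_range_succ, derivative_add, derivative_C_mul_X_pow]
    have h : ((M + (m + 1)).choose (m + 1) : ℚ[X]) * (m + 1) = (M + m + 1) * (M + m).choose m := by
      have := Nat.add_one_mul_choose_eq (M + m) m
      rw [← add_assoc]
      exact_mod_cast this.symm
    simp only [map_natCast, Nat.add_sub_cancel, map_mul, Nat.cast_mul] at ih ⊢
    push_cast at ih h ⊢
    linear_combination ih - X ^ m * h

open Polynomial in
theorem derivative_X_pow_mul_betaPoly (M m : ℕ) (hm : 1 ≤ m) :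
    derivative (X ^ m * betaPoly M m) = C (m : ℚ) * X ^ (m - 1) * (1 - X) ^ M := by
  have h1 : (1 - X : ℚ[X]) ^ M =
      ∑ i ∈ Finset.range (M + 1), C ((-1) ^ i * (M.choose i : ℚ)) * X ^ i := by
    rw [sub_eq_neg_add, add_pow]
    refine Finset.sum_congr rfl fun i _ => ?_
    rw [neg_pow, one_pow]
    simp only [map_mul, map_pow, map_neg, map_one, map_natCast]
    ring
  rw [betaPoly, h1, Finset.mul_sum, Finset.mul_sum, derivative_sum]
  refine Finset.sum_congr rfl fun i _ => ?_
  have h2 : (m : ℚ) + i ≠ 0 := by positivity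
  have h3 : X ^ m * (C ((-1) ^ i * ((m : ℚ) / (m + i)) * (M.choose i : ℚ)) * X ^ i) =
      C ((-1) ^ i * ((m : ℚ) / (m + i)) * (M.choose i : ℚ)) * X ^ (m + i) := by
    rw [pow_add]; ring
  have h4 : (-1) ^ i * ((m : ℚ) / (m + i)) * (M.choose i : ℚ) * ((m + i : ℕ) : ℚ) =
      m * ((-1) ^ i * (M.choose i : ℚ)) := by
    push_cast; field_simp
  rw [h3, derivative_C_mul_X_pow, h4, show m + i - 1 = m - 1 + i by omega, pow_add, C_mul]
  ring

open Polynomial in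
theorem X_pow_mul_betaPoly (M m : ℕ) (hm : 1 ≤ m) :
    C ((m + M).choose m : ℚ) * (X ^ m * betaPoly M m) =
      1 - (1 - X) ^ (M + 1) * ∑ i ∈ Finset.range m, C ((M + i).choose i : ℚ) * X ^ i := by
  obtain ⟨k, rfl⟩ : ∃ k, m = k + 1 := ⟨m - 1, by omega⟩
  rw [← sub_eq_zero]
  set D := C ((k + 1 + M).choose (k + 1) : ℚ) * (X ^ (k + 1) * betaPoly M (k + 1)) -
    (1 - (1 - X) ^ (M + 1) * ∑ i ∈ Finset.range (k + 1), C ((M + i).choose i : ℚ) * X ^ i) with hD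
  have hd : derivative D = 0 := by
    have h1 := derivative_X_pow_mul_betaPoly M (k + 1) hm
    have h2 := sum_choose_mul_derivative M k
    have h : ((k + 1 + M).choose (k + 1) : ℚ[X]) * (k + 1) = (M + k + 1) * (M + k).choose k := by
      have := Nat.add_one_mul_choose_eq (M + k) k
      rw [show k + 1 + M = M + k + 1 by ring]
      exact_mod_cast this.symm
    rw [hD, derivative_sub, derivative_C_mul, h1, derivative_sub, derivative_mul,
      derivative_one, derivative_pow]
    simp only [derivative_sub, derivative_one, derivative_X, Nat.add_sub_cancel, map_natCast,
      map_mul, Nat.cast_mul] at h2 ⊢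
    push_cast at h2 h ⊢
    linear_combination (1 - X) ^ M * X ^ k * h - (1 - X) ^ M * h2
  have h0 : D.coeff 0 = 0 := by
    rw [coeff_zero_eq_eval_zero, hD]
    simp [eval_finsetSum, Finset.sum_range_succ']
  rw [eq_C_of_derivative_eq_zero hd, h0, C_0]

theorem X_sq_dvd_one_sub_sinhDivSeries : PowerSeries.X ^ 2 ∣ 1 - sinhDivSeries := by
  rw [PowerSeries.X_pow_dvd_iff]
  intro k hk
  interval_cases k
  · simp [constantCoeff_sinhDivSeries]
  · simp [sinhDivSeries, PowerSeries.coeff_one]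

theorem cothCoeff_eq (m j : ℕ) (hj : 1 ≤ j) (hjm : j ≤ m) :
    cothCoeff m j = ((m + m / 2).choose m : ℚ) *
      ∑ i ∈ Finset.range (m + 1), ∑ k ∈ Finset.range (m / 2 + 1), ∑ l ∈ Finset.range (k + 1),
        (-1) ^ (k + l) * ((m : ℚ) / (m + k)) * (m.choose i : ℚ) * ((m / 2).choose k : ℚ) *
          (k.choose l : ℚ) * (((m : ℚ) - 2 * i + k - 2 * l) ^ (m + k - j) /
            (2 ^ (m + k) * (m + k - j).factorial)) := by
  set M := m / 2 with hM
  set P := (betaPoly M m).eval₂ (PowerSeries.C (R := ℚ)) sinhDivSeries with hP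
  set S := (∑ i ∈ Finset.range m, Polynomial.C ((M + i).choose i : ℚ) * Polynomial.X ^ i).eval₂
    (PowerSeries.C (R := ℚ)) sinhDivSeries
  have h1 : PowerSeries.C ((m + M).choose m : ℚ) * (sinhDivSeries ^ m * P) =
      1 - (1 - sinhDivSeries) ^ (M + 1) * S := by
    have := congrArg (Polynomial.eval₂ (PowerSeries.C (R := ℚ)) sinhDivSeries)
      (X_pow_mul_betaPoly M m (hj.trans hjm))
    simpa only [Polynomial.eval₂_mul, Polynomial.eval₂_sub, Polynomial.eval₂_pow,
      Polynomial.eval₂_C, Polynomial.eval₂_X, Polynomial.eval₂_one] using this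
  have h2 : PowerSeries.C ((m + M).choose m : ℚ) * (coshSeries ^ m * P) =
      mulCothSeries ^ m - mulCothSeries ^ m * ((1 - sinhDivSeries) ^ (M + 1) * S) := by
    rw [← mulCothSeries_mul_sinhDivSeries, mul_pow]
    linear_combination mulCothSeries ^ m * h1
  have h3 : PowerSeries.coeff (m - j)
      (mulCothSeries ^ m * ((1 - sinhDivSeries) ^ (M + 1) * S)) = 0 := by
    have hd : PowerSeries.X ^ (2 * (M + 1)) ∣
        mulCothSeries ^ m * ((1 - sinhDivSeries) ^ (M + 1) * S) := by
      rw [pow_mul]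
      exact ((pow_dvd_pow_of_dvd X_sq_dvd_one_sub_sinhDivSeries _).mul_right _).mul_left _
    exact PowerSeries.X_pow_dvd_iff.mp hd _ (by omega)
  have h4 := congrArg (PowerSeries.coeff (m - j)) h2
  rw [map_sub, h3, sub_zero, PowerSeries.coeff_C_mul] at h4
  rw [cothCoeff, if_pos hjm, ← h4, hP, betaPoly, Polynomial.eval₂_finsetSum, Finset.mul_sum,
    map_sum, Finset.sum_comm]
  congr 1
  refine Finset.sum_congr rfl fun k _ => ?_
  have h5 : PowerSeries.coeff (m - j) (coshSeries ^ m * sinhDivSeries ^ k) =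
      PowerSeries.coeff (m + k - j)
        (coshSeries ^ m * (PowerSeries.X * sinhDivSeries) ^ k) := by
    rw [mul_pow, mul_left_comm, show m + k - j = (m - j) + k by omega,
      PowerSeries.coeff_X_pow_mul]
  rw [Polynomial.eval₂_mul, Polynomial.eval₂_C, Polynomial.eval₂_pow, Polynomial.eval₂_X,
    mul_left_comm, PowerSeries.coeff_C_mul, h5, coeff_cosh_pow_mul_sinh_pow, Finset.mul_sum]
  refine Finset.sum_congr rfl fun i _ => ?_
  rw [Finset.mul_sum]
  refine Finset.sum_congr rfl fun l _ => ?_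
  rw [pow_add (-1 : ℚ)]
  ring

section
open Filter Topology MeasureTheory Set

/-- The positive numbers `x` for which `x * I` is a pole of `tanh`. -/
noncomputable def tanhPole (k : ℕ) : ℝ := Real.pi * (2 * k + 1) / 2

theorem tanhPole_pos (k : ℕ) : 0 < tanhPole k := by
  have := Real.pi_pos
  unfold tanhPole
  positivity

theorem hasSum_coth {z : ℝ} (hz : 0 < z) :
    HasSum (fun n : ℕ => 2 * z / (z ^ 2 + Real.pi ^ 2 * ((n : ℝ) + 1) ^ 2))
      (Real.cosh z / Real.sinh z - 1 / z) := by
  have hpi : (Real.pi : ℂ) ≠ 0 := by exact_mod_cast Real.pi_ne_zero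
  have hzc : (z : ℂ) ≠ 0 := by exact_mod_cast hz.ne'
  set w : ℂ := z * Complex.I / Real.pi with hw
  have hwim : w.im = z / Real.pi := by
    rw [hw, Complex.div_ofReal_im]
    simp
  have hmem : w ∈ Complex.integerComplement := by
    rintro ⟨n, hn⟩
    have := congrArg Complex.im hn
    rw [hwim] at this
    simp only [Complex.intCast_im] at this
    exact (div_pos hz Real.pi_pos).ne this
  have h := (summable_cotTerm hmem).hasSum
  have ht : ∑' n, cotTerm w n = Real.pi * Complex.cot (Real.pi * w) - 1 / w :=
    (cot_series_rep' hmem).symm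
  rw [ht] at h
  have hpw : (Real.pi : ℂ) * w = z * Complex.I := by rw [hw]; field_simp
  have hs : Complex.sinh z ≠ 0 := by
    rw [← Complex.ofReal_sinh]
    exact_mod_cast (Real.sinh_pos_iff.mpr hz).ne'
  have h2 := h.mul_left (Complex.I / Real.pi)
  have hf : ∀ n : ℕ, ((2 * z / (z ^ 2 + Real.pi ^ 2 * ((n : ℝ) + 1) ^ 2) : ℝ) : ℂ) =
      Complex.I / Real.pi * cotTerm w n := by
    intro n
    rw [cotTerm_identity hmem, hw]
    have hq : ((z : ℂ) ^ 2 + Real.pi ^ 2 * ((n : ℂ) + 1) ^ 2) ≠ 0 := by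
      have : (z ^ 2 + Real.pi ^ 2 * ((n : ℝ) + 1) ^ 2) ≠ 0 := by positivity
      exact_mod_cast this
    have hprod : ((z * Complex.I / Real.pi + ((n : ℂ) + 1)) *
        (z * Complex.I / Real.pi - ((n : ℂ) + 1))) =
        -((z : ℂ) ^ 2 + Real.pi ^ 2 * ((n : ℂ) + 1) ^ 2) / Real.pi ^ 2 := by
      field_simp
      ring_nf
      rw [Complex.I_sq]
      ring
    rw [hprod]
    push_cast
    field_simp
    rw [Complex.I_sq]
    ring
  have hv : ((Real.cosh z / Real.sinh z - 1 / z : ℝ) : ℂ) =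
      Complex.I / Real.pi * (Real.pi * Complex.cot (Real.pi * w) - 1 / w) := by
    rw [hpw, Complex.cot, Complex.cos_mul_I, Complex.sin_mul_I, hw]
    push_cast
    field_simp
  rw [← Complex.hasSum_ofReal, hv, funext hf]
  exact h2

theorem hasSum_tanh {z : ℝ} (hz : 0 < z) :
    HasSum (fun k : ℕ => 2 * z / (z ^ 2 + tanhPole k ^ 2)) (Real.tanh z) := by
  set f : ℕ → ℝ := fun n =>
    2 * (2 * (2 * z) / ((2 * z) ^ 2 + Real.pi ^ 2 * ((n : ℝ) + 1) ^ 2)) with hf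
  have h1 : HasSum f (2 * (Real.cosh (2 * z) / Real.sinh (2 * z) - 1 / (2 * z))) :=
    (hasSum_coth (z := 2 * z) (by positivity)).mul_left 2
  have hodd : ∀ k : ℕ, f (2 * k + 1) = 2 * z / (z ^ 2 + Real.pi ^ 2 * ((k : ℝ) + 1) ^ 2) := by
    intro k
    have : (z ^ 2 + Real.pi ^ 2 * ((k : ℝ) + 1) ^ 2) ≠ 0 := by positivity
    simp only [hf]
    push_cast
    rw [show (2 * z) ^ 2 + Real.pi ^ 2 * (2 * (k : ℝ) + 1 + 1) ^ 2 =
      4 * (z ^ 2 + Real.pi ^ 2 * ((k : ℝ) + 1) ^ 2) by ring]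
    field_simp
    norm_num
  have heven : ∀ k : ℕ, f (2 * k) = 2 * z / (z ^ 2 + tanhPole k ^ 2) := by
    intro k
    have : (z ^ 2 + tanhPole k ^ 2) ≠ 0 := by positivity
    simp only [hf]
    push_cast
    rw [show (2 * z) ^ 2 + Real.pi ^ 2 * (2 * (k : ℝ) + 1) ^ 2 =
      4 * (z ^ 2 + tanhPole k ^ 2) by rw [tanhPole]; ring]
    field_simp
    norm_num
  have h2 : HasSum (fun k => f (2 * k + 1)) (Real.cosh z / Real.sinh z - 1 / z) := by
    rw [funext hodd]
    exact hasSum_coth hz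
  have h3 : Summable fun k => f (2 * k) :=
    h1.summable.comp_injective (mul_right_injective₀ (two_ne_zero' ℕ))
  have h4 := (h3.hasSum.even_add_odd h2).unique h1
  have hs := (Real.sinh_pos_iff.mpr hz).ne'
  have hc := (Real.cosh_pos z).ne'
  have h5 : ∑' k, f (2 * k) = Real.tanh z := by
    rw [eq_sub_of_add_eq h4, Real.cosh_two_mul, Real.sinh_two_mul, Real.tanh_eq_sinh_div_cosh]
    field_simp
    ring
  have h6 := h3.hasSum
  rw [h5, funext heven] at h6
  exact h6

theorem summable_inv_tanhPole_pow {p : ℕ} (hp : 2 ≤ p) :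
    Summable fun k => 1 / tanhPole k ^ p := by
  have h := (Real.summable_one_div_nat_pow.mpr (show 1 < p by omega)).comp_injective
    (i := fun k : ℕ => 2 * k + 1) (fun a b hab => by simpa using hab)
  refine (h.mul_left ((2 / Real.pi) ^ p)).congr fun k => ?_
  simp only [Function.comp, tanhPole]
  have := Real.pi_ne_zero
  have h2 : (2 * (k : ℝ) + 1) ≠ 0 := by positivity
  push_cast
  rw [div_pow, div_pow, mul_pow]
  field_simp

/-- The remainder in the Taylor expansion of `tanh` at `0`, up to sign and a power of `z`. -/
noncomputable def tanhRemainder (K : ℕ) (z : ℝ) : ℝ :=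
  ∑' k, 2 / (tanhPole k ^ (2 * K) * (z ^ 2 + tanhPole k ^ 2))

/-- The absolute values of the Taylor coefficients of `tanh` at `0`. -/
noncomputable def tanhCoeff (i : ℕ) : ℝ := ∑' k, 2 / tanhPole k ^ (2 * i + 2)

theorem summable_tanhCoeff (i : ℕ) : Summable fun k => 2 / tanhPole k ^ (2 * i + 2) :=
  ((summable_inv_tanhPole_pow (show 2 ≤ 2 * i + 2 by omega)).mul_left 2).congr
    fun k => by ring

theorem tanhRemainder_term_le (K : ℕ) (z : ℝ) (k : ℕ) :
    2 / (tanhPole k ^ (2 * K) * (z ^ 2 + tanhPole k ^ 2)) ≤ 2 / tanhPole k ^ (2 * K + 2) := by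
  have := tanhPole_pos k
  rw [pow_add]
  gcongr
  nlinarith [sq_nonneg z]

theorem tanhRemainder_term_nonneg (K : ℕ) (z : ℝ) (k : ℕ) :
    0 ≤ 2 / (tanhPole k ^ (2 * K) * (z ^ 2 + tanhPole k ^ 2)) := by
  have := tanhPole_pos k
  positivity

theorem summable_tanhRemainder (K : ℕ) (z : ℝ) :
    Summable fun k => 2 / (tanhPole k ^ (2 * K) * (z ^ 2 + tanhPole k ^ 2)) :=
  Summable.of_nonneg_of_le (tanhRemainder_term_nonneg K z) (tanhRemainder_term_le K z)
    (summable_tanhCoeff K)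

theorem tanhRemainder_nonneg (K : ℕ) (z : ℝ) : 0 ≤ tanhRemainder K z :=
  tsum_nonneg (tanhRemainder_term_nonneg K z)

theorem tanhRemainder_le (K : ℕ) (z : ℝ) : tanhRemainder K z ≤ tanhCoeff K :=
  (summable_tanhRemainder K z).tsum_le_tsum (tanhRemainder_term_le K z) (summable_tanhCoeff K)

theorem tanhRemainder_succ (K : ℕ) (z : ℝ) :
    tanhRemainder K z = tanhCoeff K - z ^ 2 * tanhRemainder (K + 1) z := by
  rw [tanhRemainder, tanhCoeff, tanhRemainder, ← tsum_mul_left,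
    ← (summable_tanhCoeff K).tsum_sub ((summable_tanhRemainder (K + 1) z).mul_left _)]
  refine tsum_congr fun k => ?_
  have := tanhPole_pos k
  have h : z ^ 2 + tanhPole k ^ 2 ≠ 0 := by positivity
  rw [show 2 * (K + 1) = 2 * K + 2 by ring, pow_add]
  field_simp
  ring

theorem tanh_eq_mul_tanhRemainder {z : ℝ} (hz : 0 < z) :
    Real.tanh z = z * tanhRemainder 0 z := by
  rw [← (hasSum_tanh hz).tsum_eq, tanhRemainder, ← tsum_mul_left]
  refine tsum_congr fun k => ?_
  rw [mul_zero, pow_zero, one_mul]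
  ring

theorem tanh_taylor (K : ℕ) {z : ℝ} (hz : 0 < z) :
    Real.tanh z = ∑ i ∈ Finset.range K, (-1) ^ i * tanhCoeff i * z ^ (2 * i + 1) +
      (-1) ^ K * z ^ (2 * K + 1) * tanhRemainder K z := by
  induction K with
  | zero => simpa using tanh_eq_mul_tanhRemainder hz
  | succ K ih =>
    rw [ih, tanhRemainder_succ, Finset.sum_range_succ]
    ring

theorem hasDerivAt_arctan_div {a : ℝ} (ha : 0 < a) (z : ℝ) :
    HasDerivAt (fun z => 2 / a * Real.arctan (z / a)) (2 / (z ^ 2 + a ^ 2)) z := by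
  have h := (((hasDerivAt_id z).div_const a).arctan).const_mul (2 / a)
  have e : 2 / a * (1 / (1 + (z / a) ^ 2) * (1 / a)) = 2 / (z ^ 2 + a ^ 2) := by
    have : z ^ 2 + a ^ 2 ≠ 0 := by positivity
    field_simp
    ring
  rw [← e]
  exact h

theorem tendsto_arctan_div {a : ℝ} (ha : 0 < a) :
    Tendsto (fun z => 2 / a * Real.arctan (z / a)) atTop (𝓝 (2 / a * (Real.pi / 2))) :=
  ((tendsto_nhds_of_tendsto_nhdsWithin Real.tendsto_arctan_atTop).comp
    (tendsto_id.atTop_div_const ha)).const_mul _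

theorem integrableOn_two_div_sq_add_sq {a : ℝ} (ha : 0 < a) :
    IntegrableOn (fun z => 2 / (z ^ 2 + a ^ 2)) (Ioi 0) :=
  integrableOn_Ioi_deriv_of_nonneg' (fun z _ => hasDerivAt_arctan_div ha z)
    (fun z _ => by positivity) (tendsto_arctan_div ha)

theorem integral_two_div_sq_add_sq {a : ℝ} (ha : 0 < a) :
    ∫ z in Ioi (0 : ℝ), 2 / (z ^ 2 + a ^ 2) = Real.pi / a := by
  rw [integral_Ioi_of_hasDerivAt_of_nonneg' (fun z _ => hasDerivAt_arctan_div ha z)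
    (fun z _ => by positivity) (tendsto_arctan_div ha)]
  simp only [zero_div, Real.arctan_zero]
  field_simp
  ring

theorem hasSum_integral_tanhRemainder {K : ℕ} (hK : 1 ≤ K) :
    HasSum (fun k => Real.pi / tanhPole k ^ (2 * K + 1))
      (∫ z in Ioi (0 : ℝ), tanhRemainder K z) := by
  have hterm : ∀ k z, 2 / (tanhPole k ^ (2 * K) * (z ^ 2 + tanhPole k ^ 2)) =
      1 / tanhPole k ^ (2 * K) * (2 / (z ^ 2 + tanhPole k ^ 2)) := by
    intro k z
    have := tanhPole_pos k
    field_simp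
  have hint : ∀ k, ∫ z in Ioi (0 : ℝ), 2 / (tanhPole k ^ (2 * K) * (z ^ 2 + tanhPole k ^ 2)) =
      Real.pi / tanhPole k ^ (2 * K + 1) := by
    intro k
    have := tanhPole_pos k
    simp_rw [hterm]
    rw [integral_const_mul, integral_two_div_sq_add_sq this, pow_succ]
    field_simp
  have h := hasSum_integral_of_summable_integral_norm (μ := volume.restrict (Ioi (0 : ℝ)))
    (F := fun k z => 2 / (tanhPole k ^ (2 * K) * (z ^ 2 + tanhPole k ^ 2)))
    (fun k => by
      simp_rw [hterm]
      exact (integrableOn_two_div_sq_add_sq (tanhPole_pos k)).const_mul _)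
    (by
      simp_rw [Real.norm_of_nonneg (tanhRemainder_term_nonneg _ _ _), hint]
      exact ((summable_inv_tanhPole_pow (show 2 ≤ 2 * K + 1 by omega)).mul_left Real.pi).congr
        fun k => by ring)
  simp_rw [hint] at h
  exact h

theorem integrableOn_tanhRemainder {K : ℕ} (hK : 1 ≤ K) :
    IntegrableOn (tanhRemainder K) (Ioi 0) := by
  refine Integrable.of_integral_ne_zero ?_
  have h := hasSum_integral_tanhRemainder hK
  have hpos : ∀ k, 0 < Real.pi / tanhPole k ^ (2 * K + 1) := fun k => by
    have := tanhPole_pos k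
    positivity
  rw [← h.tsum_eq]
  exact (h.summable.tsum_pos (fun k => (hpos k).le) 0 (hpos 0)).ne'

/-- `g` has, up to `o(1)` at `0⁺`, an expansion in nonpositive powers with constant term `A`. -/
def HasFinitePart (g : ℝ → ℝ) (A : ℝ) : Prop :=
  ∃ p : Polynomial ℝ, p.coeff 0 = 0 ∧ Tendsto (fun e => g e - p.eval e⁻¹) (𝓝[>] 0) (𝓝 A)

namespace HasFinitePart

theorem of_tendsto {g : ℝ → ℝ} {A : ℝ} (h : Tendsto g (𝓝[>] 0) (𝓝 A)) : HasFinitePart g A :=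
  ⟨0, by simp, by simpa using h⟩

theorem add {f g : ℝ → ℝ} {A B : ℝ} (hf : HasFinitePart f A) (hg : HasFinitePart g B) :
    HasFinitePart (fun e => f e + g e) (A + B) := by
  obtain ⟨p, hp, hpt⟩ := hf
  obtain ⟨q, hq, hqt⟩ := hg
  refine ⟨p + q, by simp [hp, hq], (hpt.add hqt).congr fun e => ?_⟩
  rw [Polynomial.eval_add]
  ring

theorem const_mul {f : ℝ → ℝ} {A : ℝ} (c : ℝ) (hf : HasFinitePart f A) :
    HasFinitePart (fun e => c * f e) (c * A) := by
  obtain ⟨p, hp, hpt⟩ := hf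
  refine ⟨Polynomial.C c * p, by simp [hp], (hpt.const_mul c).congr fun e => ?_⟩
  rw [Polynomial.eval_mul, Polynomial.eval_C]
  ring

theorem const_mul_zero {f : ℝ → ℝ} (c : ℝ) (hf : HasFinitePart f 0) :
    HasFinitePart (fun e => c * f e) 0 := by
  simpa only [mul_zero] using hf.const_mul c

theorem congr {f g : ℝ → ℝ} {A : ℝ} (hf : HasFinitePart f A) (h : ∀ e > 0, f e = g e) :
    HasFinitePart g A := by
  obtain ⟨p, hp, hpt⟩ := hf
  refine ⟨p, hp, hpt.congr' ?_⟩
  filter_upwards [self_mem_nhdsWithin] with e he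
  rw [h e he]

theorem sum {ι : Type*} (s : Finset ι) {f : ι → ℝ → ℝ}
    (h : ∀ i ∈ s, HasFinitePart (f i) 0) : HasFinitePart (fun e => ∑ i ∈ s, f i e) 0 := by
  classical
  induction s using Finset.induction_on with
  | empty => simpa using of_tendsto tendsto_const_nhds
  | insert a s ha ih =>
    have h1 := (h a (Finset.mem_insert_self a s)).add
      (ih fun i hi => h i (Finset.mem_insert_of_mem hi))
    rw [add_zero] at h1
    exact h1.congr fun e _ => (Finset.sum_insert (f := fun i => f i e) ha).symm

theorem eq_of_tendsto {g : ℝ → ℝ} {A L : ℝ} (hg : HasFinitePart g A)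
    (h : Tendsto g (𝓝[>] 0) (𝓝 L)) : A = L := by
  obtain ⟨p, hp, hpt⟩ := hg
  have h1 : Tendsto (fun e : ℝ => p.eval e⁻¹) (𝓝[>] 0) (𝓝 (L - A)) :=
    (h.sub hpt).congr fun e => by ring
  have h2 : Tendsto (fun x => p.eval x) atTop (𝓝 (L - A)) := by
    refine (h1.comp tendsto_inv_atTop_nhdsGT_zero).congr fun x => ?_
    simp
  obtain ⟨h3, h4⟩ := p.tendsto_nhds_iff.mp h2
  rw [Polynomial.eq_C_of_degree_le_zero h4, hp, Polynomial.C_0, Polynomial.leadingCoeff_zero] at h3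
  linarith

theorem inv_pow {r : ℕ} (hr : r ≠ 0) : HasFinitePart (fun e => 1 / e ^ r) 0 := by
  refine ⟨Polynomial.X ^ r, by simp [hr.symm], tendsto_const_nhds.congr fun e => ?_⟩
  simp

theorem pow_div_pow {a n : ℕ} (h : a ≠ n) : HasFinitePart (fun e => e ^ a / e ^ n) 0 := by
  rcases lt_or_gt_of_ne h with h | h
  · refine (inv_pow (r := n - a) (by omega)).congr fun e he => ?_
    rw [← Nat.sub_add_cancel h.le, pow_add]
    have : e ≠ 0 := he.ne'
    field_simp
    simp
  · have h1 : HasFinitePart (fun e => e ^ (a - n)) 0 := by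
      refine of_tendsto ?_
      have : Tendsto (fun e : ℝ => e ^ (a - n)) (𝓝 0) (𝓝 (0 ^ (a - n))) :=
        (continuous_pow _).tendsto _
      rw [zero_pow (by omega)] at this
      exact tendsto_nhdsWithin_of_tendsto_nhds this
    refine h1.congr fun e he => ?_
    have : e ≠ 0 := he.ne'
    rw [eq_div_iff (pow_ne_zero _ this), ← pow_add, Nat.sub_add_cancel h.le]

end HasFinitePart

theorem continuous_real_tanh : Continuous Real.tanh := by
  have : Real.tanh = fun x => Real.sinh x / Real.cosh x :=
    funext Real.tanh_eq_sinh_div_cosh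
  rw [this]
  exact Real.continuous_sinh.div₀ Real.continuous_cosh fun x => (Real.cosh_pos x).ne'

theorem hasDerivAt_real_tanh (x : ℝ) : HasDerivAt Real.tanh (1 - Real.tanh x ^ 2) x := by
  have h := (Real.hasDerivAt_sinh x).div (Real.hasDerivAt_cosh x) (Real.cosh_pos x).ne'
  have e : Real.tanh = fun x => Real.sinh x / Real.cosh x :=
    funext Real.tanh_eq_sinh_div_cosh
  have e2 : 1 - Real.tanh x ^ 2 = (Real.cosh x * Real.cosh x - Real.sinh x * Real.sinh x) /
      Real.cosh x ^ 2 := by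
    have := (Real.cosh_pos x).ne'
    rw [Real.tanh_eq_sinh_div_cosh]
    field_simp
  rw [e2, e]
  exact h

theorem hasFinitePart_tanh_pow (m : ℕ) : ∀ a n : ℕ, Odd (m + a + n) →
    HasFinitePart (fun e => Real.tanh e ^ m * (e ^ a / e ^ n)) 0 := by
  induction m with
  | zero =>
    intro a n h
    refine (HasFinitePart.pow_div_pow (a := a) (n := n) ?_).congr fun e _ => by simp
    rintro rfl
    rw [zero_add] at h
    exact (Nat.not_odd_iff_even.mpr (Even.add_self a)) h
  | succ m ih =>
    intro a n h
    have h1 := HasFinitePart.sum (Finset.range n) fun i _ =>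
      (ih (a + (2 * i + 1)) n (by convert h.add_even (even_two_mul i) using 1; ring)).const_mul_zero
        ((-1) ^ i * tanhCoeff i)
    have h2 : HasFinitePart (fun e => (-1) ^ n * (Real.tanh e ^ m *
        (e ^ (a + n + 1) * tanhRemainder n e))) 0 := by
      refine HasFinitePart.of_tendsto ?_
      have t1 : Tendsto (fun e : ℝ => e ^ (a + n + 1) * tanhRemainder n e) (𝓝[>] 0) (𝓝 0) := by
        have t0 : Tendsto (fun e : ℝ => e ^ (a + n + 1) * tanhCoeff n) (𝓝[>] 0) (𝓝 0) := by
          have : Tendsto (fun e : ℝ => e ^ (a + n + 1) * tanhCoeff n) (𝓝 0)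
              (𝓝 (0 ^ (a + n + 1) * tanhCoeff n)) :=
            ((continuous_pow _).mul continuous_const).tendsto _
          rw [zero_pow (by omega), zero_mul] at this
          exact tendsto_nhdsWithin_of_tendsto_nhds this
        refine tendsto_of_tendsto_of_tendsto_of_le_of_le' tendsto_const_nhds t0 ?_ ?_
        · filter_upwards [self_mem_nhdsWithin] with e he
          exact mul_nonneg (pow_nonneg (le_of_lt he) _) (tanhRemainder_nonneg n e)
        · filter_upwards [self_mem_nhdsWithin] with e he
          exact mul_le_mul_of_nonneg_left (tanhRemainder_le n e) (pow_nonneg (le_of_lt he) _)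
      have t2 : Tendsto (fun e : ℝ => Real.tanh e ^ m) (𝓝[>] 0) (𝓝 (Real.tanh 0 ^ m)) :=
        tendsto_nhdsWithin_of_tendsto_nhds ((continuous_real_tanh.pow m).tendsto 0)
      simpa using (t2.mul t1).const_mul ((-1) ^ n)
    have h3 := h1.add h2
    rw [add_zero] at h3
    refine h3.congr fun e he => ?_
    have he' : e ≠ 0 := he.ne'
    have ht : Real.tanh e ^ (m + 1) * (e ^ a / e ^ n) =
        Real.tanh e ^ m * ((∑ i ∈ Finset.range n, (-1) ^ i * tanhCoeff i * e ^ (2 * i + 1) +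
          (-1) ^ n * e ^ (2 * n + 1) * tanhRemainder n e) * (e ^ a / e ^ n)) := by
      rw [← tanh_taylor n he, pow_succ, mul_assoc]
    rw [ht, add_mul, mul_add, Finset.sum_mul, Finset.mul_sum]
    refine congrArg₂ (· + ·) (Finset.sum_congr rfl fun i _ => ?_) ?_
    · rw [pow_add]; ring
    · rw [show 2 * n + 1 = n + (n + 1) by ring, pow_add e n, add_assoc, pow_add e a]
      field_simp

theorem hasDerivAt_neg_inv_pow (r : ℕ) {z : ℝ} (hz : 0 < z) :
    HasDerivAt (fun z : ℝ => -(1 / ((r + 1) * z ^ (r + 1)))) (1 / z ^ (r + 2)) z := by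
  have hz' := hz.ne'
  have hr : ((r : ℝ) + 1) ≠ 0 := by positivity
  have h := (((hasDerivAt_pow (r + 1) z).const_mul ((r : ℝ) + 1)).fun_inv
    (mul_ne_zero hr (pow_ne_zero _ hz'))).neg
  have e : -(-(((r : ℝ) + 1) * (((r + 1 : ℕ) : ℝ) * z ^ (r + 1 - 1))) /
      (((r : ℝ) + 1) * z ^ (r + 1)) ^ 2) = 1 / z ^ (r + 2) := by
    rw [Nat.add_sub_cancel]
    push_cast
    field_simp
    ring
  rw [← e]
  refine h.congr_of_eventuallyEq (Eventually.of_forall fun x => ?_)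
  simp [one_div]

theorem tendsto_neg_inv_pow (r : ℕ) :
    Tendsto (fun z : ℝ => -(1 / ((r + 1) * z ^ (r + 1)))) atTop (𝓝 0) := by
  have h : Tendsto (fun z : ℝ => (r + 1) * z ^ (r + 1)) atTop atTop :=
    (tendsto_pow_atTop (by omega)).const_mul_atTop (by positivity)
  simpa using h.inv_tendsto_atTop.neg

theorem integrableOn_inv_pow (r : ℕ) {e : ℝ} (he : 0 < e) :
    IntegrableOn (fun z : ℝ => 1 / z ^ (r + 2)) (Ioi e) :=
  integrableOn_Ioi_deriv_of_nonneg'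
    (fun _ hz => hasDerivAt_neg_inv_pow r (he.trans_le hz))
    (fun z hz => by have : 0 < z := he.trans hz; positivity) (tendsto_neg_inv_pow r)

theorem integral_inv_pow (r : ℕ) {e : ℝ} (he : 0 < e) :
    ∫ z in Ioi e, 1 / z ^ (r + 2) = 1 / (r + 1) * (1 / e ^ (r + 1)) := by
  rw [integral_Ioi_of_hasDerivAt_of_nonneg'
    (fun _ hz => hasDerivAt_neg_inv_pow r (he.trans_le hz))
    (fun z hz => by have : 0 < z := he.trans hz; positivity) (tendsto_neg_inv_pow r)]
  have := he.ne'
  field_simp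
  simp

theorem hasFinitePart_integral_inv_pow (r : ℕ) :
    HasFinitePart (fun e => ∫ z in Ioi e, 1 / z ^ (r + 2)) 0 := by
  have h := (HasFinitePart.inv_pow (r := r + 1) (by omega)).const_mul_zero (1 / ((r : ℝ) + 1))
  exact h.congr fun e he => (integral_inv_pow r he).symm

theorem abs_real_tanh_le_one (z : ℝ) : |Real.tanh z| ≤ 1 :=
  abs_le.mpr ⟨(Real.neg_one_lt_tanh z).le, (Real.tanh_lt_one z).le⟩

theorem measurable_tanhIntegrand (m n : ℕ) : Measurable (tanhIntegrand m n) :=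
  (continuous_real_tanh.measurable.pow_const m).div (measurable_id.pow_const n)

theorem integrableOn_tanhIntegrand_tail (m : ℕ) {n : ℕ} (hn : 2 ≤ n) {e : ℝ} (he : 0 < e) :
    IntegrableOn (tanhIntegrand m n) (Ioi e) := by
  obtain ⟨r, rfl⟩ : ∃ r, n = r + 2 := ⟨n - 2, by omega⟩
  refine (integrableOn_inv_pow r he).mono'
    (measurable_tanhIntegrand m _).aestronglyMeasurable ?_
  filter_upwards [ae_restrict_mem measurableSet_Ioi] with z hz
  have hz' : 0 < z := he.trans hz
  rw [tanhIntegrand, norm_div, norm_pow, norm_pow, Real.norm_eq_abs, Real.norm_eq_abs,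
    abs_of_pos hz']
  gcongr
  exact pow_le_one₀ (abs_nonneg _) (abs_real_tanh_le_one z)

theorem integral_tanhIntegrand_recurrence (m : ℕ) {n : ℕ} (hn : 2 ≤ n) {e : ℝ} (he : 0 < e) :
    ∫ z in Ioi e, tanhIntegrand (m + 2) n z =
      (∫ z in Ioi e, tanhIntegrand m n z) +
        (-(n / (m + 1)) * (∫ z in Ioi e, tanhIntegrand (m + 1) (n + 1) z) +
          1 / (m + 1) * (Real.tanh e ^ (m + 1) * (e ^ 0 / e ^ n))) := by
  have hm : ((m : ℝ) + 1) ≠ 0 := by positivity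
  have hd : ∀ z ∈ Ici e, HasDerivAt (tanhIntegrand (m + 1) n)
      ((m + 1) * tanhIntegrand m n z - (m + 1) * tanhIntegrand (m + 2) n z -
        n * tanhIntegrand (m + 1) (n + 1) z) z := by
    intro z hz
    have hz' : z ≠ 0 := (he.trans_le hz).ne'
    have h := ((hasDerivAt_real_tanh z).pow (m + 1)).div (hasDerivAt_pow n z)
      (pow_ne_zero n hz')
    refine HasDerivAt.congr_deriv h ?_
    obtain ⟨k, rfl⟩ : ∃ k, n = k + 1 := ⟨n - 1, by omega⟩
    simp only [tanhIntegrand, Nat.add_sub_cancel, Pi.pow_apply]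
    push_cast
    field_simp
    ring
  have i1 := (integrableOn_tanhIntegrand_tail m hn he).const_mul ((m : ℝ) + 1)
  have i2 := (integrableOn_tanhIntegrand_tail (m + 2) hn he).const_mul ((m : ℝ) + 1)
  have i3 := (integrableOn_tanhIntegrand_tail (m + 1) (hn.trans n.le_succ) he).const_mul (n : ℝ)
  have ht : Tendsto (tanhIntegrand (m + 1) n) atTop (𝓝 0) := by
    have h0 : Tendsto (fun z : ℝ => 1 / z ^ n) atTop (𝓝 0) := by
      simp_rw [one_div]
      exact (tendsto_pow_atTop (by omega)).inv_tendsto_atTop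
    refine squeeze_zero_norm' ?_ h0
    filter_upwards [eventually_gt_atTop 0] with z hz
    rw [tanhIntegrand, norm_div, norm_pow, norm_pow, Real.norm_eq_abs, Real.norm_eq_abs,
      abs_of_pos hz]
    gcongr
    exact pow_le_one₀ (abs_nonneg _) (abs_real_tanh_le_one z)
  have i12 : IntegrableOn (fun z => (m + 1) * tanhIntegrand m n z -
      (m + 1) * tanhIntegrand (m + 2) n z) (Ioi e) := i1.sub i2
  have h := integral_Ioi_of_hasDerivAt_of_tendsto' hd (i12.sub i3) ht
  have e1 : ∫ z in Ioi e, ((m + 1) * tanhIntegrand m n z - (m + 1) * tanhIntegrand (m + 2) n z -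
      n * tanhIntegrand (m + 1) (n + 1) z) =
      (m + 1) * (∫ z in Ioi e, tanhIntegrand m n z) -
        (m + 1) * (∫ z in Ioi e, tanhIntegrand (m + 2) n z) -
        n * ∫ z in Ioi e, tanhIntegrand (m + 1) (n + 1) z := by
    rw [integral_sub i12 i3, integral_sub i1 i2, integral_const_mul, integral_const_mul,
      integral_const_mul]
  rw [e1, tanhIntegrand] at h
  have he' := he.ne'
  field_simp
  rw [zero_sub, eq_neg_iff_add_eq_zero] at h
  field_simp at h
  linear_combination -h

theorem tendsto_integral_Ioi_of_integrableOn {f : ℝ → ℝ} (hf : IntegrableOn f (Ioi 0)) :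
    Tendsto (fun e => ∫ z in Ioi e, f z) (𝓝[>] 0) (𝓝 (∫ z in Ioi 0, f z)) := by
  have hc : AECover (volume.restrict (Ioi (0 : ℝ))) (𝓝[>] (0 : ℝ)) fun e => Ioi e :=
    aecover_Ioi_of_Ioi (tendsto_nhdsWithin_of_tendsto_nhds tendsto_id)
  refine (hc.integral_tendsto_of_countably_generated hf).congr' ?_
  filter_upwards [self_mem_nhdsWithin] with e he
  rw [Measure.restrict_restrict measurableSet_Ioi,
    inter_eq_left.mpr (Ioi_subset_Ioi (le_of_lt he))]

theorem integrableOn_tanhIntegrand {m n : ℕ} (hn : 2 ≤ n) (hnm : n ≤ m) :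
    IntegrableOn (tanhIntegrand m n) (Ioi 0) := by
  rw [← Ioc_union_Ioi_eq_Ioi (zero_le_one' ℝ)]
  refine IntegrableOn.union ?_ (integrableOn_tanhIntegrand_tail m hn one_pos)
  refine Integrable.mono' (g := fun _ => tanhCoeff 0 ^ n) (integrable_const _)
    (measurable_tanhIntegrand m n).aestronglyMeasurable ?_
  filter_upwards [ae_restrict_mem measurableSet_Ioc] with z hz
  have hz' : 0 < z := hz.1
  have h0 : 0 ≤ Real.tanh z := by
    rw [tanh_eq_mul_tanhRemainder hz']
    exact mul_nonneg hz'.le (tanhRemainder_nonneg 0 z)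
  have h1 : Real.tanh z ≤ tanhCoeff 0 * z := by
    rw [tanh_eq_mul_tanhRemainder hz', mul_comm]
    exact mul_le_mul_of_nonneg_right (tanhRemainder_le 0 z) hz'.le
  rw [tanhIntegrand, Real.norm_of_nonneg (by positivity), div_le_iff₀ (by positivity), ← mul_pow]
  exact (pow_le_pow_of_le_one h0 (Real.tanh_lt_one z).le hnm).trans (pow_le_pow_left₀ h0 h1 n)

/-- The finite part of `∫ tanh(z) / z ^ N` for odd `N ≥ 3`. -/
noncomputable def tanhFinitePart (N : ℕ) : ℝ :=
  (-1) ^ (N / 2) * ∑' k, Real.pi / tanhPole k ^ N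

theorem hasFinitePart_integral_tanh {n : ℕ} (hn : 2 ≤ n) (hodd : Odd n) :
    HasFinitePart (fun e => ∫ z in Ioi e, tanhIntegrand 1 n z) (tanhFinitePart n) := by
  obtain ⟨K, rfl⟩ := hodd
  have hK : 1 ≤ K := by omega
  have hG := integrableOn_tanhRemainder hK
  have h1 := HasFinitePart.sum (Finset.range K) fun i _ =>
    (hasFinitePart_integral_inv_pow (2 * (K - 1 - i))).const_mul_zero ((-1) ^ i * tanhCoeff i)
  have h2 := (HasFinitePart.of_tendsto
    (tendsto_integral_Ioi_of_integrableOn hG)).const_mul ((-1) ^ K)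
  have h3 := h1.add h2
  have hA : 0 + (-1) ^ K * ∫ z in Ioi 0, tanhRemainder K z = tanhFinitePart (2 * K + 1) := by
    rw [tanhFinitePart, (hasSum_integral_tanhRemainder hK).tsum_eq,
      show (2 * K + 1) / 2 = K by omega, zero_add]
  rw [hA] at h3
  refine h3.congr fun e he => ?_
  have he0 : 0 < e := he
  have hi : ∀ i ∈ Finset.range K, IntegrableOn (fun z : ℝ =>
      (-1) ^ i * tanhCoeff i * (1 / z ^ (2 * (K - 1 - i) + 2))) (Ioi e) := fun i _ =>
    (integrableOn_inv_pow (2 * (K - 1 - i)) he0).const_mul _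
  have hG' : IntegrableOn (fun z => (-1) ^ K * tanhRemainder K z) (Ioi e) :=
    (hG.mono_set (Ioi_subset_Ioi he0.le)).const_mul _
  simp_rw [← integral_const_mul]
  rw [← integral_finsetSum _ hi, ← integral_add (integrable_finsetSum _ hi) hG']
  refine setIntegral_congr_fun measurableSet_Ioi fun z hz => ?_
  have hz0 : 0 < z := he0.trans hz
  have hz' : z ≠ 0 := hz0.ne'
  simp only [tanhIntegrand, pow_one]
  rw [tanh_taylor K hz0, add_div, Finset.sum_div]
  refine congrArg₂ (· + ·) (Finset.sum_congr rfl fun i hi => ?_) ?_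
  · have hi' : i < K := Finset.mem_range.mp hi
    rw [show 2 * K + 1 = (2 * i + 1) + (2 * (K - 1 - i) + 2) by omega, pow_add z (2 * i + 1)]
    field_simp
  · field_simp

theorem succ_mul_ring_choose_neg (n i : ℕ) :
    ((i : ℤ) + 1) * Ring.choose (-(n : ℤ)) (i + 1) =
      -(n : ℤ) * Ring.choose (-((n + 1 : ℕ) : ℤ)) i := by
  have h1 := Ring.descPochhammer_eq_factorial_smul_choose (-(n : ℤ)) (i + 1)
  have h2 := Ring.descPochhammer_eq_factorial_smul_choose (-((n + 1 : ℕ) : ℤ)) i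
  rw [← Polynomial.eval_eq_smeval] at h1 h2
  rw [descPochhammer_succ_left, Polynomial.eval_mul, Polynomial.eval_X, Polynomial.eval_comp,
    Polynomial.eval_sub, Polynomial.eval_X, Polynomial.eval_one,
    show -(n : ℤ) - 1 = -((n + 1 : ℕ) : ℤ) by push_cast; ring, h2, Nat.factorial_succ,
    nsmul_eq_mul, nsmul_eq_mul] at h1
  have h3 : (i.factorial : ℤ) ≠ 0 := by exact_mod_cast i.factorial_ne_zero
  apply mul_left_cancel₀ h3
  push_cast at h1 ⊢
  linear_combination -h1

theorem cothCoeff_eq_zero_of_odd (m : ℕ) : ∀ i : ℕ, Even (m + i) → cothCoeff m (i + 1) = 0 := by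
  induction m using Nat.twoStepInduction with
  | zero => intro i _; simp [cothCoeff]
  | one =>
    rintro i hi
    rw [cothCoeff, if_neg]
    rintro h
    obtain rfl : i = 0 := by omega
    exact absurd hi (by decide)
  | more m ih1 ih2 =>
    intro i hi
    rw [cothCoeff_recurrence, ih1 i (by
      rw [Nat.even_iff] at hi ⊢; omega)]
    cases i with
    | zero => simp
    | succ i =>
      rw [ih2 i (by rw [Nat.even_iff] at hi ⊢; omega)]
      simp

/-- The claimed value of the finite part of `∫ tanh(z)^m / z^n`. -/
noncomputable def tanhPowFinitePart (m n : ℕ) : ℝ :=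
  ∑ i ∈ Finset.range m, (cothCoeff m (i + 1) : ℝ) * ((Ring.choose (-(n : ℤ)) i : ℤ) : ℝ) *
    tanhFinitePart (n + i)

theorem tanhPowFinitePart_recurrence (m n : ℕ) :
    tanhPowFinitePart (m + 2) n =
      tanhPowFinitePart m n + -(n / (m + 1)) * tanhPowFinitePart (m + 1) (n + 1) := by
  have h1 : tanhPowFinitePart m n = ∑ i ∈ Finset.range (m + 2), (cothCoeff m (i + 1) : ℝ) *
      ((Ring.choose (-(n : ℤ)) i : ℤ) : ℝ) * tanhFinitePart (n + i) := by
    refine Finset.sum_subset (by intro x; simp; omega) fun i _ hi => ?_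
    rw [cothCoeff, if_neg (by simp at hi; omega)]
    simp
  have h2 : -((n : ℝ) / (m + 1)) * tanhPowFinitePart (m + 1) (n + 1) =
      ∑ i ∈ Finset.range (m + 2), (i : ℝ) / (m + 1) * (cothCoeff (m + 1) i : ℝ) *
        ((Ring.choose (-(n : ℤ)) i : ℤ) : ℝ) * tanhFinitePart (n + i) := by
    rw [Finset.sum_range_succ', tanhPowFinitePart, Finset.mul_sum]
    simp only [Nat.cast_zero, zero_div, zero_mul, add_zero]
    refine Finset.sum_congr rfl fun i _ => ?_
    have h : ((i : ℝ) + 1) * ((Ring.choose (-(n : ℤ)) (i + 1) : ℤ) : ℝ) =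
        -(n : ℝ) * ((Ring.choose (-((n + 1 : ℕ) : ℤ)) i : ℤ) : ℝ) := by
      exact_mod_cast succ_mul_ring_choose_neg n i
    rw [show n + 1 + i = n + (i + 1) by ring]
    rw [Nat.cast_add i 1, Nat.cast_one]
    linear_combination (-(cothCoeff (m + 1) (i + 1) : ℝ) * tanhFinitePart (n + (i + 1)) /
      ((m : ℝ) + 1)) * h
  rw [h1, h2, tanhPowFinitePart, ← Finset.sum_add_distrib]
  refine Finset.sum_congr rfl fun i _ => ?_
  rw [cothCoeff_recurrence]
  push_cast
  ring

theorem hasFinitePart_integral_tanhIntegrand (m : ℕ) : ∀ n : ℕ, 2 ≤ n → Even (m + n) →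
    HasFinitePart (fun e => ∫ z in Ioi e, tanhIntegrand m n z) (tanhPowFinitePart m n) := by
  induction m using Nat.twoStepInduction with
  | zero =>
    intro n hn _
    obtain ⟨r, rfl⟩ : ∃ r, n = r + 2 := ⟨n - 2, by omega⟩
    simpa [tanhIntegrand, tanhPowFinitePart] using hasFinitePart_integral_inv_pow r
  | one =>
    intro n hn h
    have hodd : Odd n := by rw [Nat.even_iff] at h; rw [Nat.odd_iff]; omega
    simpa [tanhPowFinitePart, cothCoeff_one_one] using hasFinitePart_integral_tanh hn hodd
  | more m ih1 ih2 =>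
    intro n hn h
    have h1 := ih1 n hn (by rw [Nat.even_iff] at h ⊢; omega)
    have h2 := (ih2 (n + 1) (by omega) (by rw [Nat.even_iff] at h ⊢; omega)).const_mul
      (-((n : ℝ) / (m + 1)))
    have h3 := (hasFinitePart_tanh_pow (m + 1) 0 n
      (by rw [Nat.even_iff] at h; rw [Nat.odd_iff]; omega)).const_mul_zero (1 / ((m : ℝ) + 1))
    have h4 := h1.add (h2.add h3)
    rw [add_zero, ← tanhPowFinitePart_recurrence] at h4
    exact h4.congr fun e he => (integral_tanhIntegrand_recurrence m hn he).symm

theorem tanhIntegral_eq_tanhPowFinitePart {m n : ℕ} (hn : 2 ≤ n) (hnm : n ≤ m)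
    (h : Even (m + n)) : tanhIntegral m n = tanhPowFinitePart m n :=
  ((hasFinitePart_integral_tanhIntegrand m n hn h).eq_of_tendsto
    (tendsto_integral_Ioi_of_integrableOn (integrableOn_tanhIntegrand hn hnm))).symm

theorem tsum_inv_odd_pow {N : ℕ} (hN : 2 ≤ N) :
    ((∑' k : ℕ, 1 / (2 * (k : ℝ) + 1) ^ N : ℝ) : ℂ) = (1 - 1 / 2 ^ N) * riemannZeta N := by
  set f : ℕ → ℝ := fun n => 1 / (n : ℝ) ^ N with hf
  have hs : Summable f := Real.summable_one_div_nat_pow.mpr (by omega)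
  have he : ∀ k, f (2 * k) = 1 / 2 ^ N * f k := fun k => by
    simp only [hf]
    push_cast
    rw [mul_pow]
    ring
  have ho : ∀ k : ℕ, f (2 * k + 1) = 1 / (2 * (k : ℝ) + 1) ^ N := fun k => by
    simp only [hf]
    push_cast
    rfl
  have h1 : HasSum (fun k => f (2 * k)) (1 / 2 ^ N * ∑' n, f n) := by
    rw [funext he]
    exact hs.hasSum.mul_left _
  have h2 : Summable fun k => f (2 * k + 1) :=
    hs.comp_injective (i := fun k : ℕ => 2 * k + 1) (fun a b hab => by simpa using hab)
  have h3 := (h1.even_add_odd h2.hasSum).unique hs.hasSum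
  have hz : riemannZeta N = ((∑' n, f n : ℝ) : ℂ) := by
    rw [zeta_nat_eq_tsum_of_gt_one (by omega), Complex.ofReal_tsum]
    refine tsum_congr fun n => ?_
    simp only [hf]
    push_cast
    rfl
  rw [hz, ← tsum_congr ho, eq_sub_of_add_eq' h3]
  push_cast
  ring

theorem tanhFinitePart_eq {N : ℕ} (hN : 2 ≤ N) :
    (tanhFinitePart N : ℂ) = (-1) ^ (N / 2) * (2 ^ N - 1) / Real.pi ^ (N - 1) * riemannZeta N := by
  have hpi : (Real.pi : ℂ) ≠ 0 := by exact_mod_cast Real.pi_ne_zero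
  have h1 : ∑' k, Real.pi / tanhPole k ^ N =
      2 ^ N / Real.pi ^ (N - 1) * ∑' k : ℕ, 1 / (2 * (k : ℝ) + 1) ^ N := by
    rw [← tsum_mul_left]
    refine tsum_congr fun k => ?_
    have := Real.pi_ne_zero
    have h2 : (2 * (k : ℝ) + 1) ≠ 0 := by positivity
    obtain ⟨r, rfl⟩ : ∃ r, N = r + 1 := ⟨N - 1, by omega⟩
    rw [tanhPole, div_pow, mul_pow, Nat.add_sub_cancel, pow_succ Real.pi]
    field_simp
  rw [tanhFinitePart, h1]
  push_cast [tsum_inv_odd_pow hN]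
  field_simp

theorem tanhFinitePart_eq_of_odd {N : ℕ} (hN : 2 ≤ N) (h : Odd N) :
    (tanhFinitePart N : ℂ) =
      ((2 : ℂ) ^ N - 1) / ((Real.pi : ℂ) * Complex.I) ^ (N - 1) * riemannZeta N := by
  have hpi : (Real.pi : ℂ) ≠ 0 := by exact_mod_cast Real.pi_ne_zero
  obtain ⟨K, rfl⟩ := h
  rw [tanhFinitePart_eq hN, show (2 * K + 1) / 2 = K by omega, Nat.add_sub_cancel, mul_pow,
    pow_mul Complex.I, Complex.I_sq]
  have h1 : ((-1 : ℂ) ^ K) * (-1) ^ K = 1 := by rw [← mul_pow]; simp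
  have h2 : ((-1 : ℂ) ^ K) ≠ 0 := pow_ne_zero _ (by simp)
  field_simp
  linear_combination (2 ^ (2 * K + 1) - 1) * riemannZeta ((2 * K + 1 : ℕ) : ℂ) * h1

theorem tanhIntegral_eq_sum {m n : ℕ} (hn : 2 ≤ n) (hnm : n ≤ m) (h : m ≡ n [MOD 2]) :
    (tanhIntegral m n : ℂ) = ∑ j ∈ (Finset.Icc 1 m).filter (fun j => j ≡ m [MOD 2]),
      (cothCoeff m j : ℂ) * ((Ring.choose (-(n : ℤ)) (j - 1) : ℤ) : ℂ) *
        (tanhFinitePart (n + j - 1) : ℂ) := by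
  have hev : Even (m + n) := by
    unfold Nat.ModEq at h
    rw [Nat.even_iff]
    omega
  rw [tanhIntegral_eq_tanhPowFinitePart hn hnm hev, tanhPowFinitePart,
    Finset.sum_filter_of_ne, ← Finset.Ico_add_one_right_eq_Icc, Finset.sum_Ico_eq_sum_range,
    Nat.add_sub_cancel]
  · push_cast
    refine Finset.sum_congr rfl fun i _ => ?_
    rw [add_comm 1 i, Nat.add_sub_cancel, ← add_assoc, Nat.add_sub_cancel]
  · intro j hj hne
    by_contra hjm
    apply hne
    obtain ⟨i, rfl⟩ : ∃ i, j = i + 1 := ⟨j - 1, by have := (Finset.mem_Icc.mp hj).1; omega⟩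
    rw [cothCoeff_eq_zero_of_odd m i (by unfold Nat.ModEq at hjm; rw [Nat.even_iff]; omega)]
    simp

theorem ceil_half_eq (m : ℕ) : ⌈(m : ℚ) / 2⌉₊ = (m + 1) / 2 := by
  refine eq_of_forall_ge_iff fun c => ?_
  rw [Nat.ceil_le, div_le_iff₀ two_pos]
  have : ((m : ℚ) ≤ c * 2) ↔ m ≤ c * 2 := by exact_mod_cast Iff.rfl
  rw [this]
  omega

theorem sum_filter_modEq_eq_sum_Icc (m : ℕ) (f : ℕ → ℂ) :
    ∑ j ∈ (Finset.Icc 1 m).filter (fun j => j ≡ m [MOD 2]), f j =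
      ∑ k ∈ Finset.Icc 1 ⌈(m : ℚ) / 2⌉₊, f (m + 2 - 2 * k) := by
  rw [ceil_half_eq]
  refine Finset.sum_nbij' (fun j => (m + 2 - j) / 2) (fun k => m + 2 - 2 * k) ?_ ?_ ?_ ?_ ?_
  · intro j hj
    obtain ⟨h1, h2⟩ := Finset.mem_filter.mp hj
    rw [Finset.mem_Icc] at h1 ⊢
    unfold Nat.ModEq at h2
    omega
  · intro k hk
    rw [Finset.mem_Icc] at hk
    rw [Finset.mem_filter, Finset.mem_Icc, Nat.ModEq]
    omega
  · intro j hj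
    obtain ⟨h1, h2⟩ := Finset.mem_filter.mp hj
    rw [Finset.mem_Icc] at h1
    unfold Nat.ModEq at h2
    omega
  · intro k hk
    rw [Finset.mem_Icc] at hk
    omega
  · intro j hj
    obtain ⟨h1, h2⟩ := Finset.mem_filter.mp hj
    rw [Finset.mem_Icc] at h1
    unfold Nat.ModEq at h2
    congr 1
    omega

theorem cothCoeff_self (m : ℕ) : cothCoeff m m = 1 := by
  have h : PowerSeries.constantCoeff mulCothSeries = 1 := by
    have := cothCoeff_one_one
    simpa [cothCoeff] using this
  simp [cothCoeff, h]

theorem tanhIntegral_two_two :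
    (tanhIntegral 2 2 : ℂ) = 14 * riemannZeta 3 / (Real.pi : ℂ) ^ 2 := by
  have hf : (Finset.Icc 1 2).filter (fun j => j ≡ 2 [MOD 2]) = {2} := by decide
  rw [tanhIntegral_eq_sum le_rfl le_rfl rfl, hf, Finset.sum_singleton, cothCoeff_self,
    Ring.choose_one_right, tanhFinitePart_eq (by norm_num)]
  norm_num
  ring

theorem exists_rat_tanhIntegral_eq {m n : ℕ} (hn : 2 ≤ n) (hnm : n ≤ m) (h : m ≡ n [MOD 2]) :
    ∃ c : ℕ → ℚ, (tanhIntegral m n : ℂ) = ∑ k ∈ Finset.Icc 1 ⌈(m : ℚ) / 2⌉₊,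
      (c k : ℂ) * (riemannZeta ((m + n - 2 * k + 1 : ℕ) : ℂ) /
        (Real.pi : ℂ) ^ (m + n - 2 * k)) := by
  refine ⟨fun k => cothCoeff m (m + 2 - 2 * k) *
    (Ring.choose (-(n : ℤ)) (m + 2 - 2 * k - 1) : ℤ) *
    ((-1) ^ ((m + n - 2 * k + 1) / 2) * (2 ^ (m + n - 2 * k + 1) - 1)), ?_⟩
  rw [tanhIntegral_eq_sum hn hnm h, sum_filter_modEq_eq_sum_Icc m fun j => (cothCoeff m j : ℂ) *
    ((Ring.choose (-(n : ℤ)) (j - 1) : ℤ) : ℂ) * (tanhFinitePart (n + j - 1) : ℂ)]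
  refine Finset.sum_congr rfl fun k hk => ?_
  rw [ceil_half_eq, Finset.mem_Icc] at hk
  rw [show n + (m + 2 - 2 * k) - 1 = m + n - 2 * k + 1 by omega, tanhFinitePart_eq (by omega),
    Nat.add_sub_cancel]
  push_cast
  ring

end

theorem mainTheorem1 :
    (∀ m n : ℕ, 2 ≤ n → n ≤ m → m ≡ n [MOD 2] →
      MeasureTheory.IntegrableOn (tanhIntegrand m n) (Set.Ioi (0 : ℝ)) ∧
      (tanhIntegral m n : ℂ) =
        (Nat.choose (m + m / 2) m : ℂ) *
          ∑ j ∈ (Finset.Icc 1 m).filter (fun j => j ≡ m [MOD 2]),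
            ((Ring.choose (-(n : ℤ)) (j - 1) : ℤ) : ℂ) *
              (((2 : ℂ) ^ (n + j - 1) - 1) / ((Real.pi : ℂ) * Complex.I) ^ (n + j - 2)) *
              riemannZeta ((n + j - 1 : ℕ) : ℂ) *
              ∑ lam ∈ Finset.range (m + 1), ∑ mu ∈ Finset.range (m / 2 + 1),
                ∑ nu ∈ Finset.range (mu + 1),
                  (-1 : ℂ) ^ (mu + nu) * ((m : ℂ) / ((m : ℂ) + (mu : ℂ))) *
                    (Nat.choose m lam : ℂ) * (Nat.choose (m / 2) mu : ℂ) *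
                    (Nat.choose mu nu : ℂ) *
                    (((m : ℂ) - 2 * (lam : ℂ) + (mu : ℂ) - 2 * (nu : ℂ)) ^ (m + mu - j) /
                      ((2 : ℂ) ^ (m + mu) * (Nat.factorial (m + mu - j) : ℂ))) ∧
      ∃ c : ℕ → ℚ,
        (tanhIntegral m n : ℂ) =
          ∑ k ∈ Finset.Icc 1 ⌈(m : ℚ) / 2⌉₊,
            (c k : ℂ) *
              (riemannZeta ((m + n - 2 * k + 1 : ℕ) : ℂ) /
                (Real.pi : ℂ) ^ (m + n - 2 * k))) ∧
    (tanhIntegral 2 2 : ℂ) = 14 * riemannZeta 3 / (Real.pi : ℂ) ^ 2 := by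
  refine ⟨fun m n hn hnm h => ⟨integrableOn_tanhIntegrand hn hnm, ?_,
    exists_rat_tanhIntegral_eq hn hnm h⟩, tanhIntegral_two_two⟩
  rw [tanhIntegral_eq_sum hn hnm h, Finset.mul_sum]
  refine Finset.sum_congr rfl fun j hj => ?_
  obtain ⟨hj1, hj2⟩ := Finset.mem_filter.mp hj
  obtain ⟨hj3, hj4⟩ := Finset.mem_Icc.mp hj1
  have hodd : Odd (n + j - 1) := by
    unfold Nat.ModEq at h hj2
    rw [Nat.odd_iff]
    omega
  rw [tanhFinitePart_eq_of_odd (by omega) hodd, cothCoeff_eq m j hj3 hj4,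
    show n + j - 1 - 1 = n + j - 2 by omega]
  push_cast
  ring
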